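/- Let $M$ be the sphere, the Euclidean plane or the hyperbolic plane of constant curvature $k\in\mathbb R$ ($k>0$, $k=0$, $k<0$ respectively), with a distinguished point $O$ as origin. For a disk of radius $r$ in $M$ let $2\pi\ell(r)$ be its circumference, $2\pi a(r)$ its area and $c(r)$ the geodesic curvature of its boundary; explicitly $\ell(r)=\frac{\sin(\sqrt k\,r)}{\sqrt k},\ r,\ \frac{\sinh(\sqrt{-k}\,r)}{\sqrt{-k}}$, $\;a(r)=\frac{1-\cos(\sqrt k\,r)}{k},\ \frac{r^2}{2},\ \frac{1-\cosh(\sqrt{-k}\,r)}{k}$ and $c(r)=\sqrt k\cot(\sqrt k\,r),\ \frac1r,\ \sqrt{-k}\coth(\sqrt{-k}\,r)$ for $k>0$, $k=0$, $k<0$. These formulas are also used for negative $r$, and the product $\ell(r)c(r)$ is given its limit value $1$ at $r=0$. Let $K\subset M$ be a convex body (compact, geodesically convex, with nonempty interior) whose boundary $\partial K$ is a regular simple closed $C^2$ curve, traversed once in the positive direction (with $K$ on the left); if $k>0$, assume that $K$ lies in the open hemisphere centred at $O$. The origin need not lie in $K$. Let $s$ be arclength on $\partial K$, $\mathcal P$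 the perimeter of $K$ (the length of $\partial K$) and $\kappa_g$ the geodesic curvature of $\partial K$ (nonnegative for convex $K$). For $P\in\partial K$ let * $(\rho,\theta)$ be the geodesic polar coordinates of $P$ about $O$, with $\theta$ chosen continuously along $\partial K\setminus\{O\}$ (if $O\in\partial K$, the integrals below are taken over $\partial K\setminus\{O\}$); * $r$ be the signed distance from $O$ to the support line of $K$ at $P$ ($r>0$ if $O$ lies strictly on the same side of it as $K$, $r<0$ if it lies strictly on the other side), and $F$ the point of the support line closest to $O$; * $\omega$ be the central angle such that $F$ has polar coordinates $(r,\omega)$ (for $r<0$: at distance $|r|$ in the direction $\omega+\pi$) and moving from $F$ in the direction of increasing first coordinate leads away from $K$; $\omega$ is chosen continuously along $\partial K$; * $x$ be the distance between $P$ and $F$, with the sign of $\omega-\theta$ (taken in $(-\pi,\pi)$). Then $\omega$ is differentiable along $\partial K$, $\theta$ is differentiable along $\partial K\setminus\{O\}$, and $$\mathcal P=\int_{\partial K}\ell(\rho)^2\,\frac{d\omega}{ds}\,d\theta=\int_{\partial K}\kappa_g\,\ell(\rho)^2\,\frac{\ell(x)c(x)}{\ell(r)c(r)}\,d\theta=\int_{\partial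 K}\kappa_g\,\ell(\rho)^2\,\frac{1-k\,a(x)}{1-k\,a(r)}\,d\theta .$$ The first integrand is the integrand of the Cauchy formula $\mathcal P=\int\ell(r)\,d\omega$ expressed in the polar angle: $\ell(r)\,d\omega=\ell(\rho)^2\frac{d\omega}{ds}\,d\theta$ at every point of $\partial K\setminus\{O\}$. If $k\ne0$ and $\partial K$ is not a circle centred at $O$, then it differs, at some point of $\partial K\setminus\{O\}$, from the integrand $\kappa_g\,\ell(\rho)^2\,d\theta+k\,a(\rho)\,ds$ of the Minkowski formula. -/

import Mathlib

noncomputable section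

namespace ConstCurv

/-- `ell k r = L(r) / 2π`, where `L(r)` is the circumference of a circle of radius `r` in the plane
of constant curvature `k` (odd in `r`). -/
def ell (k r : ℝ) : ℝ :=
  if 0 < k then Real.sin (√k * r) / √k
  else if k = 0 then r
  else Real.sinh (√(-k) * r) / √(-k)

/-- `area k r = A(r) / 2π`, where `A(r)` is the area of a disk of radius `r` in the plane of
constant curvature `k`. -/
def area (k r : ℝ) : ℝ :=
  if 0 < k then (1 - Real.cos (√k * r)) / k
  else if k = 0 then r ^ 2 / 2
  else (1 - Real.cosh (√(-k) * r)) / k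

/-- The geodesic curvature `c(r)` of a circle of radius `r ≠ 0` in the plane of constant
curvature `k`. -/
def circCurv (k r : ℝ) : ℝ :=
  if 0 < k then √k * (Real.cos (√k * r) / Real.sin (√k * r))
  else if k = 0 then 1 / r
  else √(-k) * (Real.cosh (√(-k) * r) / Real.sinh (√(-k) * r))

/-- The product `ℓ(r) c(r)`, with its limit `1` as value at the removable singularity `r = 0`. -/
def ellCurv (k r : ℝ) : ℝ :=
  if r = 0 then 1 else ell k r * circCurv k r

/-- The simply connected plane of constant curvature `k`: the locus `p₀² + k (p₁² + p₂²) = 1`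
(the sheet `p₀ > 0` if `k ≤ 0`) with the Riemannian metric `dp₁² + dp₂² + dp₀² / k`.

* `k > 0`: `(p₀ / √k, p₁, p₂)` runs over the Euclidean sphere of radius `1 / √k`;
* `k = 0`: the Euclidean plane `{1} × ℝ²`;
* `k < 0`: `(p₀ / √(-k), p₁, p₂)` runs over the upper sheet of the hyperboloid
  `p₁² + p₂² - z² = 1 / k` in Minkowski space. -/
abbrev Plane (k : ℝ) : Type :=
  {p : Fin 3 → ℝ // p 0 ^ 2 + k * (p 1 ^ 2 + p 2 ^ 2) = 1 ∧ (k ≤ 0 → 0 < p 0)}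

/-- The Riemannian metric `dp₁² + dp₂² + dp₀² / k` on tangent vectors. If `k = 0` then tangent
vectors have vanishing `0`-th component; the last term then is `0`, also by the convention
`a / 0 = 0`. -/
def inner (k : ℝ) (v w : Fin 3 → ℝ) : ℝ :=
  v 1 * w 1 + v 2 * w 2 + v 0 * w 0 / k

/-- Geodesic distance in the plane of curvature `k`. -/
def dist (k : ℝ) (P Q : Plane k) : ℝ :=
  let b : ℝ := P.1 0 * Q.1 0 + k * (P.1 1 * Q.1 1 + P.1 2 * Q.1 2)
  if 0 < k then Real.arccos b / √k
  else if k = 0 then √((P.1 1 - Q.1 1) ^ 2 + (P.1 2 - Q.1 2) ^ 2)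
  else Real.arcosh b / √(-k)

theorem ell_area (k r : ℝ) : (1 - k * area k r) ^ 2 + k * ell k r ^ 2 = 1 := by
  unfold area ell
  split_ifs with h1 h2
  · have h : √k ^ 2 = k := Real.sq_sqrt h1.le
    have h0 : k ≠ 0 := h1.ne'
    rw [div_pow, h, mul_div_cancel₀ _ h0, mul_div_cancel₀ _ h0]
    linarith [Real.sin_sq_add_cos_sq (√k * r)]
  · subst h2; simp
  · have h : √(-k) ^ 2 = -k := Real.sq_sqrt (by linarith)
    rw [div_pow, h, mul_div_cancel₀ _ h2, div_neg, mul_neg, mul_div_cancel₀ _ h2]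
    linarith [Real.cosh_sq (√(-k) * r)]

theorem area_pos (k r : ℝ) (hk : k ≤ 0) : 0 < 1 - k * area k r := by
  unfold area
  split_ifs with h1 h2
  · linarith
  · subst h2; simp
  · rw [mul_div_cancel₀ _ h2]
    linarith [Real.cosh_pos (√(-k) * r)]

/-- The point with geodesic polar coordinates `(r, φ)` about the origin. A negative `r` means going
the distance `|r|` in the direction opposite to `φ`. -/
def polar (k r φ : ℝ) : Plane k :=
  ⟨![1 - k * area k r, ell k r * Real.cos φ, ell k r * Real.sin φ], by
    refine ⟨?_, fun hk => area_pos k r hk⟩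
    simp only [Matrix.cons_val_zero, Matrix.cons_val_one, Matrix.cons_val]
    have h := ell_area k r
    have h' := Real.sin_sq_add_cos_sq φ
    linear_combination h + k * ell k r ^ 2 * h'⟩

/-- The distinguished point `O`, with coordinates `(1, 0, 0)`. -/
def origin (k : ℝ) : Plane k := ⟨![1, 0, 0], by simp⟩

/-- Let `w` be a nonzero tangent vector at `P`. The geodesic line through `P` in the direction `w`
is `{X | side P w X = 0}`, and `X` lies strictly to the left of this directed line if and only if
`0 < side P w X`. On tangent vectors, `side P` is the oriented area form. -/
def side (P w X : Fin 3 → ℝ) : ℝ := Matrix.det ![P, w, X]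

/-- Rotation by `+90°` of a tangent vector `w` at `P`:
the tangent vector with `inner k (rot k P w) z = side P w z` for tangent `z`. -/
def rot (k : ℝ) (P w : Fin 3 → ℝ) : Fin 3 → ℝ :=
  ![k * (P 1 * w 2 - P 2 * w 1), P 2 * w 0 - P 0 * w 2, P 0 * w 1 - P 1 * w 0]

/-- The (shortest) geodesic segment between two points that are not antipodal. -/
def geodSegment {k : ℝ} (P Q : Plane k) : Set (Plane k) :=
  {X | ∃ a b : ℝ, 0 ≤ a ∧ 0 ≤ b ∧ X.1 = a • P.1 + b • Q.1}

/-- Convex bodies: compact, geodesically convex, with interior points. On the sphere they are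
required to lie in the open hemisphere about the origin; for `k ≤ 0` the last condition always
holds. -/
structure IsConvexBody {k : ℝ} (K : Set (Plane k)) : Prop where
  isCompact : IsCompact K
  nonempty_interior : (interior K).Nonempty
  convex : ∀ P ∈ K, ∀ Q ∈ K, geodSegment P Q ⊆ K
  hemisphere : ∀ P ∈ K, 0 < P.1 0

/-- The velocity of a curve. -/
def vel {k : ℝ} (γ : ℝ → Plane k) (t : ℝ) : Fin 3 → ℝ := deriv (fun u => (γ u).1) t

/-- The speed `ds/dt` of a curve, `s` being arclength. -/
def speed {k : ℝ} (γ : ℝ → Plane k) (t : ℝ) : ℝ := √(inner k (vel γ t) (vel γ t))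

/-- The unit tangent vector of a curve. -/
def unitTangent {k : ℝ} (γ : ℝ → Plane k) (t : ℝ) : Fin 3 → ℝ := (speed γ t)⁻¹ • vel γ t

/-- The geodesic curvature `⟨D𝐓/ds, 𝐓⊥⟩`, with `𝐓⊥` the unit tangent `𝐓` turned by `+90°`. The
derivative of `𝐓` in the ambient space may stand for the covariant derivative, as the two differ by
a multiple of the position vector, which is orthogonal to the tangent vector `𝐓⊥`. -/
def geodCurv {k : ℝ} (γ : ℝ → Plane k) (t : ℝ) : ℝ :=
  inner k ((speed γ t)⁻¹ • deriv (unitTangent γ) t) (rot k (γ t).1 (unitTangent γ t))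

/-- `γ`, restricted to a period `[0, T)`, is a regular `C²` parametrization of the boundary of the
convex body `K`, once around in the positive direction (`K` lies to the left). -/
structure IsBoundaryParam {k : ℝ} (K : Set (Plane k)) (T : ℝ) (γ : ℝ → Plane k) : Prop where
  pos : 0 < T
  contDiff : ContDiff ℝ 2 (fun t => (γ t).1)
  regular : ∀ t, vel γ t ≠ 0
  periodic : Function.Periodic γ T
  injOn : Set.InjOn γ (Set.Ico 0 T)
  range_eq : Set.range γ = frontier K
  oriented : ∀ t, ∀ Q ∈ interior K, 0 < side (γ t).1 (vel γ t) Q.1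

/-- The perimeter: the length `∫ ds` of the closed boundary curve. -/
def perimeter {k : ℝ} (T : ℝ) (γ : ℝ → Plane k) : ℝ := ∫ t in (0 : ℝ)..T, speed γ t

/-- The support line of `K` at `P` is the geodesic perpendicular at the point `F = polar k r ω` to
the geodesic from the origin in the direction `ω`. Here `F` is the point of that line closest to
the origin (hence `|r| < π / (2 √k)` if `k > 0`), and `K` lies on the side of the line that does not
contain the points `polar k (r + ε) ω` with small `ε > 0`. Thus `r` is the signed distance from the
origin to the support line, positive if `K` and the origin are strictly on the same side. The
vector `(0, -sin ω, cos ω)` is tangent at `F`, perpendicular to the radial direction. -/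
structure IsSupportLine {k : ℝ} (K : Set (Plane k)) (P : Plane k) (r ω : ℝ) : Prop where
  closest : 0 < k → |r| < Real.pi / (2 * √k)
  supports : ∀ X ∈ K, 0 ≤ side (polar k r ω).1 ![0, -Real.sin ω, Real.cos ω] X.1
  mem : side (polar k r ω).1 ![0, -Real.sin ω, Real.cos ω] P.1 = 0

/-- The distance `ρ` of a point from the origin. -/
def rho {k : ℝ} (P : Plane k) : ℝ := dist k (origin k) P

/-- The signed distance `x` between `P` and the foot `polar k r ω` of the perpendicular from the
origin to the support line; `θ` is the polar angle of `P`, and `x` has the sign of `ω - θ` (taken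
in `(-π, π]`). -/
def thirdSide {k : ℝ} (P : Plane k) (θ r ω : ℝ) : ℝ :=
  Real.sign (Real.sin (ω - θ)) * dist k P (polar k r ω)

end ConstCurv

end

namespace ConstCurv

open Filter Topology

/-! Write `C(y) = 1 - k a(y)` for the generalized cosine, `p₀ = C(ρ)` for the `0`-th coordinate of
the boundary point, `u` for the unit tangent and `m = supp γ`. In the linear model the tangent line
is the kernel of the covector `(m, n₁, n₂)`, where `n` is the unit normal, and `n₁² + n₂² + k m² =
1`. Since the support line is the tangent line (`IsSupportLine.eq_tangent`), `m = ℓ(r)` and `(n₁,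
n₂) = -C(r) (cos ω, sin ω)`.

So `ω` and `θ` are polar angles of explicit plane curves. The Frenet equation `n' = -κ u` gives
`dω/ds = κ p₀ / C(r)²`, and angular momentum gives `ℓ(ρ)² dθ/ds = m`. With Pythagoras, `p₀ = C(r)
C(x)`, and `ℓ c = C`, all three integrands become `ℓ(r) dω`.

The Cauchy formula holds because `dx = ℓ(r) dω - ds` and `x` returns to its initial value after one
period. In `perimeter_eq` the function `-x` appears as an antiderivative of `1 / (1 + k z²)`
evaluated at `z = radial γ / p₀`.

Equality with the Minkowski integrand gives a linear first-order equation for `radial γ` away from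
`O`. This function vanishes at the extrema of `p₀`, so by uniqueness `p₀` is constant
(`coord_zero_const`). -/

/-! ### Polar angles and the generalized trigonometric functions -/

/-- A continuous polar angle of a differentiable plane curve is differentiable. -/
theorem hasDerivAt_polarAngle {φ a b R : ℝ → ℝ} {t a' b' : ℝ} (hφ : ContinuousAt φ t)
    (ha : HasDerivAt a a' t) (hb : HasDerivAt b b' t)
    (h : ∀ᶠ s in 𝓝 t, R s ≠ 0 ∧ a s = R s * Real.cos (φ s) ∧ b s = R s * Real.sin (φ s)) :
    HasDerivAt φ ((a t * b' - b t * a') / (a t ^ 2 + b t ^ 2)) t := by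
  obtain ⟨hR, hat, hbt⟩ := h.self_of_nhds
  set c := Real.cos (φ t)
  set s := Real.sin (φ t)
  have hcs : s ^ 2 + c ^ 2 = 1 := Real.sin_sq_add_cos_sq _
  have hden : a t * c + b t * s = R t := by
    rw [hat, hbt]; linear_combination R t * hcs
  have hnum : b t * c - a t * s = 0 := by rw [hat, hbt]; ring
  have hsq : a t ^ 2 + b t ^ 2 = R t ^ 2 := by
    rw [hat, hbt]; linear_combination R t ^ 2 * hcs
  -- Rotating by `-φ t` brings the angle into `(-π/2, π/2)`, where `arctan` inverts `tan`. The
  -- factor `R` cancels in the quotient, so its sign does not matter.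
  have hloc : φ =ᶠ[𝓝 t] fun u => φ t + Real.arctan ((b u * c - a u * s) / (a u * c + b u * s)) := by
    have hball : ∀ᶠ u in 𝓝 t, |φ u - φ t| < Real.pi / 2 := by
      have := Metric.continuousAt_iff'.1 hφ (Real.pi / 2) (by positivity)
      simpa [Real.dist_eq] using this
    filter_upwards [h, hball] with u hu hu'
    obtain ⟨hRu, hau, hbu⟩ := hu
    have h1 : b u * c - a u * s = R u * Real.sin (φ u - φ t) := by
      rw [hau, hbu, Real.sin_sub]; ring
    have h2 : a u * c + b u * s = R u * Real.cos (φ u - φ t) := by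
      rw [hau, hbu, Real.cos_sub]; ring
    rw [h1, h2, mul_div_mul_left _ _ hRu, ← Real.tan_eq_sin_div_cos,
      Real.arctan_tan (abs_lt.1 hu').1 (abs_lt.1 hu').2]
    ring
  refine HasDerivAt.congr_of_eventuallyEq ?_ hloc
  have hd := ((((hb.mul_const c).sub (ha.mul_const s)).div
    ((ha.mul_const c).add (hb.mul_const s)) (by simpa [hden] using hR)).arctan).const_add (φ t)
  refine hd.congr_deriv ?_
  simp only [Pi.div_apply, Pi.add_apply, Pi.sub_apply, hden, hnum, hsq]
  rw [hat, hbt]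
  field_simp
  ring

/-- An antiderivative of `1 / (1 + k z²)` where `0 < 1 + k z²`. -/
theorem exists_antideriv (k : ℝ) :
    ∃ G : ℝ → ℝ, ∀ z, 0 < 1 + k * z ^ 2 → HasDerivAt G (1 / (1 + k * z ^ 2)) z := by
  rcases lt_trichotomy k 0 with hk | rfl | hk
  · obtain ⟨a, ha, rfl⟩ : ∃ a : ℝ, 0 < a ∧ k = -a ^ 2 :=
      ⟨√(-k), Real.sqrt_pos.2 (by linarith), by rw [Real.sq_sqrt (by linarith)]; ring⟩
    refine ⟨fun z => (Real.log (1 + a * z) - Real.log (1 - a * z)) / (2 * a), fun z hz => ?_⟩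
    have habs : |a * z| < 1 := by rw [← sq_lt_one_iff_abs_lt_one]; nlinarith
    have h1 : 0 < 1 + a * z := by linarith [(abs_lt.1 habs).1]
    have h2 : 0 < 1 - a * z := by linarith [(abs_lt.1 habs).2]
    have hz0 : HasDerivAt (fun z => a * z) a z := by simpa using (hasDerivAt_id z).const_mul a
    have hd := (((hz0.const_add 1).log h1.ne').sub ((hz0.const_sub 1).log h2.ne')).div_const (2 * a)
    refine hd.congr_deriv ?_
    have h3 : 1 + -a ^ 2 * z ^ 2 = (1 + a * z) * (1 - a * z) := by ring
    rw [h3]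
    field_simp
    ring
  · exact ⟨id, fun z _ => by simpa using hasDerivAt_id z⟩
  · obtain ⟨a, ha, rfl⟩ : ∃ a : ℝ, 0 < a ∧ k = a ^ 2 :=
      ⟨√k, Real.sqrt_pos.2 hk, (Real.sq_sqrt hk.le).symm⟩
    refine ⟨fun z => Real.arctan (a * z) / a, fun z hz => ?_⟩
    have hz0 : HasDerivAt (fun z => a * z) a z := by simpa using (hasDerivAt_id z).const_mul a
    refine (hz0.arctan.div_const a).congr_deriv ?_
    rw [mul_pow]
    field_simp

theorem cosFactor_pos {k r : ℝ} (h : 0 < k → |r| < Real.pi / (2 * √k)) :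
    0 < 1 - k * area k r := by
  by_cases hk : 0 < k
  · have ha : 0 < √k := Real.sqrt_pos.2 hk
    have hr := h hk
    rw [lt_div_iff₀ (by positivity)] at hr
    have h2 : |√k * r| < Real.pi / 2 := by rw [abs_mul, abs_of_pos ha]; linarith
    simp only [area, if_pos hk, mul_div_cancel₀ _ hk.ne']
    linarith [Real.cos_pos_of_mem_Ioo (abs_lt.1 h2)]
  · exact area_pos k r (not_lt.1 hk)

/-- The bound excludes nonzero `r` where the sine vanishes; there division by zero would make the
product `0` instead of the generalized cosine. -/
theorem ellCurv_eq {k r : ℝ} (h : 0 < k → |√k * r| < Real.pi) :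
    ellCurv k r = 1 - k * area k r := by
  by_cases hr : r = 0
  · subst hr
    simp [ellCurv, area]
  simp only [ellCurv, if_neg hr, ell, circCurv, area]
  split_ifs with h1 h2
  · have ha : 0 < √k := Real.sqrt_pos.2 h1
    have hs : Real.sin (√k * r) ≠ 0 := by
      intro hs
      have hh := abs_lt.1 (h h1)
      have := (Real.sin_eq_zero_iff_of_lt_of_lt hh.1 hh.2).1 hs
      simp [ha.ne', hr] at this
    rw [mul_div_cancel₀ _ h1.ne']
    field_simp
    ring
  · subst h2; field_simp; ring
  · have ha : 0 < √(-k) := Real.sqrt_pos.2 (by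
      rcases lt_or_eq_of_le (not_lt.1 h1) with h | h
      · linarith
      · exact absurd h h2)
    have hs : Real.sinh (√(-k) * r) ≠ 0 := by
      rw [Ne, Real.sinh_eq_zero]; simp [ha.ne', hr]
    rw [mul_div_cancel₀ _ h2]
    field_simp
    ring

/-- The cosine of a signed distance. -/
theorem cosFactor_sign_mul_dist {k : ℝ} (P Q : Plane k) (s b : ℝ)
    (hb : b = P.1 0 * Q.1 0 + k * (P.1 1 * Q.1 1 + P.1 2 * Q.1 2))
    (hb0 : 0 < b) (hpos : 0 < k → b ≤ 1) (hneg : k < 0 → 1 ≤ b) (hzero : k = 0 → b = 1)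
    (hs : s = 0 → b = 1) :
    1 - k * area k (Real.sign s * dist k P Q) = b ∧
      (0 < k → |√k * (Real.sign s * dist k P Q)| < Real.pi) := by
  simp only [dist, ← hb]
  rcases lt_trichotomy k 0 with hk | rfl | hk
  · have ha : 0 < √(-k) := Real.sqrt_pos.2 (by linarith)
    refine ⟨?_, fun h => absurd h (not_lt.2 hk.le)⟩
    simp only [area, if_neg (not_lt.2 hk.le), if_neg hk.ne, mul_div_cancel₀ _ hk.ne]
    have hc : Real.cosh (Real.arcosh b) = b := Real.cosh_arcosh (hneg hk)
    have he : ∀ e : ℝ, √(-k) * (e * (Real.arcosh b / √(-k))) = e * Real.arcosh b := by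
      intro e; field_simp
    rw [he]
    rcases lt_trichotomy s 0 with h | h | h
    · simp [Real.sign_of_neg h, hc]
    · simp [h, hs h]
    · simp [Real.sign_of_pos h, hc]
  · exact ⟨by simp [hzero rfl], fun h => absurd h (lt_irrefl _)⟩
  · have ha : 0 < √k := Real.sqrt_pos.2 hk
    simp only [area, if_pos hk, mul_div_cancel₀ _ hk.ne']
    have hc : Real.cos (Real.arccos b) = b := Real.cos_arccos (by linarith) (hpos hk)
    have he : ∀ e : ℝ, √k * (e * (Real.arccos b / √k)) = e * Real.arccos b := by
      intro e; field_simp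
    rw [he]
    -- Positivity of `b` keeps the distance below a quarter of a great circle.
    have hlt : Real.arccos b < Real.pi :=
      lt_of_lt_of_le (Real.arccos_lt_pi_div_two.2 hb0) (by linarith [Real.pi_pos])
    have h0 := Real.arccos_nonneg b
    rcases lt_trichotomy s 0 with h | h | h
    · simp [Real.sign_of_neg h, hc, abs_of_nonneg h0, hlt]
    · simp [h, hs h, Real.pi_pos]
    · simp [Real.sign_of_pos h, hc, abs_of_nonneg h0, hlt]

/-! ### The moving frame of the boundary curve -/

/-- The support function `side P u O` of the tangent line at a point of a curve. -/
noncomputable def supp {k : ℝ} (γ : ℝ → Plane k) (t : ℝ) : ℝ :=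
  (γ t).1 1 * unitTangent γ t 2 - (γ t).1 2 * unitTangent γ t 1

/-- The radial component of the unit tangent vector of a curve. -/
noncomputable def radial {k : ℝ} (γ : ℝ → Plane k) (t : ℝ) : ℝ :=
  ((γ t).1 1 * unitTangent γ t 1 + (γ t).1 2 * unitTangent γ t 2) / (γ t).1 0

variable {k : ℝ} {K : Set (Plane k)} {T : ℝ} {γ : ℝ → Plane k}

theorem IsBoundaryParam.coord_zero_pos (hγ : IsBoundaryParam K T γ) (hK : IsConvexBody K) (t : ℝ) :
    0 < (γ t).1 0 := by
  apply hK.hemisphere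
  have : γ t ∈ frontier K := hγ.range_eq ▸ Set.mem_range_self t
  exact hK.isCompact.isClosed.frontier_subset this

theorem IsBoundaryParam.hasDerivAt (hγ : IsBoundaryParam K T γ) (t : ℝ) (i : Fin 3) :
    HasDerivAt (fun s => (γ s).1 i) (vel γ t i) t :=
  hasDerivAt_pi.1 ((hγ.contDiff.differentiable (by norm_num)).differentiableAt.hasDerivAt) i

theorem IsBoundaryParam.contDiff_vel (hγ : IsBoundaryParam K T γ) : ContDiff ℝ 1 (vel γ) := by
  have h : ContDiff ℝ (1 + 1) (fun t => (γ t).1) := by simpa [one_add_one_eq_two] using hγ.contDiff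
  exact (contDiff_succ_iff_deriv.1 h).2.2

theorem vel_orthogonal (hγ : IsBoundaryParam K T γ) (t : ℝ) :
    (γ t).1 0 * vel γ t 0 + k * ((γ t).1 1 * vel γ t 1 + (γ t).1 2 * vel γ t 2) = 0 := by
  have h := ((hγ.hasDerivAt t 0).pow 2).add
    ((((hγ.hasDerivAt t 1).pow 2).add ((hγ.hasDerivAt t 2).pow 2)).const_mul k)
  have hc : HasDerivAt (fun s => (γ s).1 0 ^ 2 + k * ((γ s).1 1 ^ 2 + (γ s).1 2 ^ 2)) 0 t := by
    simp only [fun s => (γ s).2.1]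
    exact hasDerivAt_const t 1
  have := h.unique hc
  norm_num at this
  linarith

theorem inner_vel_pos (hγ : IsBoundaryParam K T γ) (hK : IsConvexBody K) (t : ℝ) :
    0 < inner k (vel γ t) (vel γ t) := by
  have h0 := hγ.coord_zero_pos hK t
  have ho := vel_orthogonal hγ t
  have hP := (γ t).2.1
  have hne : vel γ t 1 ≠ 0 ∨ vel γ t 2 ≠ 0 := by
    by_contra! h
    apply hγ.regular t
    rw [h.1, h.2] at ho
    have hv : vel γ t 0 = 0 := by simpa [h0.ne'] using ho
    ext i
    fin_cases i
    · exact hv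
    · exact h.1
    · exact h.2
  simp only [inner]
  generalize vel γ t 0 = a at *
  generalize vel γ t 1 = b at *
  generalize vel γ t 2 = c at *
  generalize (γ t).1 0 = p at *
  generalize (γ t).1 1 = q at *
  generalize (γ t).1 2 = r at *
  have hbc : 0 < b ^ 2 + c ^ 2 := by
    rcases hne with h | h <;> positivity
  -- For `k < 0` the ambient form is indefinite. Tangency eliminates `a`, and what remains is
  -- visibly positive when `k ≤ 0`.
  have key : p ^ 2 * (b * b + c * c + a * a / k) = b ^ 2 + c ^ 2 - k * (q * c - r * b) ^ 2 := by
    by_cases hk : k = 0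
    · subst hk
      simp only [div_zero]
      linear_combination (b ^ 2 + c ^ 2) * hP
    · field_simp
      linear_combination k * (b ^ 2 + c ^ 2) * hP + (p * a - k * (q * b + r * c)) * ho
  rcases le_or_gt k 0 with hk | hk
  · have : 0 < p ^ 2 * (b * b + c * c + a * a / k) := by
      rw [key]; nlinarith [mul_nonneg (neg_nonneg.2 hk) (sq_nonneg (q * c - r * b))]
    exact (mul_pos_iff_of_pos_left (by positivity)).1 this
  · have : 0 ≤ a * a / k := div_nonneg (mul_self_nonneg a) hk.le
    nlinarith

theorem speed_pos (hγ : IsBoundaryParam K T γ) (hK : IsConvexBody K) (t : ℝ) : 0 < speed γ t :=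
  Real.sqrt_pos.2 (inner_vel_pos hγ hK t)

theorem contDiff_speed (hγ : IsBoundaryParam K T γ) (hK : IsConvexBody K) :
    ContDiff ℝ 1 (speed γ) := by
  have h := contDiff_pi.1 hγ.contDiff_vel
  refine ContDiff.sqrt ?_ fun t => (inner_vel_pos hγ hK t).ne'
  exact (((h 1).mul (h 1)).add ((h 2).mul (h 2))).add (((h 0).mul (h 0)).div_const k)

theorem contDiff_unitTangent (hγ : IsBoundaryParam K T γ) (hK : IsConvexBody K) :
    ContDiff ℝ 1 (unitTangent γ) :=
  ((contDiff_speed hγ hK).inv fun t => (speed_pos hγ hK t).ne').smul hγ.contDiff_vel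

theorem hasDerivAt_unitTangent (hγ : IsBoundaryParam K T γ) (hK : IsConvexBody K) (t : ℝ)
    (i : Fin 3) : HasDerivAt (fun s => unitTangent γ s i) (deriv (unitTangent γ) t i) t :=
  hasDerivAt_pi.1
    (((contDiff_unitTangent hγ hK).differentiable (by norm_num)).differentiableAt.hasDerivAt) i

theorem vel_eq (hγ : IsBoundaryParam K T γ) (hK : IsConvexBody K) (t : ℝ) (i : Fin 3) :
    vel γ t i = speed γ t * unitTangent γ t i := by
  have := (speed_pos hγ hK t).ne'
  simp [unitTangent, this]

/-- This removes the division by `k` from the metric: `u₀² / k` turns into `k radial²`, and the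
later identities are polynomial in `k`, with `k = 0` included. -/
theorem unitTangent_zero (hγ : IsBoundaryParam K T γ) (hK : IsConvexBody K) (t : ℝ) :
    unitTangent γ t 0 = -k * radial γ t := by
  have h0 := (hγ.coord_zero_pos hK t).ne'
  have hs := (speed_pos hγ hK t).ne'
  have ho := vel_orthogonal hγ t
  simp only [vel_eq hγ hK] at ho
  simp only [radial]
  field_simp
  apply mul_left_cancel₀ hs
  linear_combination ho

theorem radial_mul (hγ : IsBoundaryParam K T γ) (hK : IsConvexBody K) (t : ℝ) :
    (γ t).1 0 * radial γ t =
      (γ t).1 1 * unitTangent γ t 1 + (γ t).1 2 * unitTangent γ t 2 := by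
  have h0 := (hγ.coord_zero_pos hK t).ne'
  simp only [radial]
  field_simp

theorem unitTangent_norm (hγ : IsBoundaryParam K T γ) (hK : IsConvexBody K) (t : ℝ) :
    unitTangent γ t 1 ^ 2 + unitTangent γ t 2 ^ 2 + k * radial γ t ^ 2 = 1 := by
  have hs := (speed_pos hγ hK t).ne'
  have h : speed γ t ^ 2 = inner k (vel γ t) (vel γ t) := Real.sq_sqrt (inner_vel_pos hγ hK t).le
  simp only [inner, vel_eq hγ hK, unitTangent_zero hγ hK] at h
  apply mul_left_cancel₀ (pow_ne_zero 2 hs)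
  rw [mul_one]
  nth_rewrite 2 [h]
  by_cases hk : k = 0
  · subst hk; simp; ring
  · field_simp

/-- Lagrange's identity for `(p₁, p₂)` and `(u₁, u₂)`, combined with the equations of the surface
and of the unit tangent. Once `supp γ t = ℓ(r)` is known, the right side is `C(r)²`, and this is
Pythagoras in the triangle with vertices `O`, `P`, `F`. -/
theorem supp_sq (hγ : IsBoundaryParam K T γ) (hK : IsConvexBody K) (t : ℝ) :
    (γ t).1 0 ^ 2 + k * radial γ t ^ 2 = 1 - k * supp γ t ^ 2 := by
  have h1 := unitTangent_norm hγ hK t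
  have h2 := radial_mul hγ hK t
  have hP := (γ t).2.1
  have h0 := (hγ.coord_zero_pos hK t).ne'
  simp only [supp]
  generalize (γ t).1 0 = p at *
  generalize (γ t).1 1 = q at *
  generalize (γ t).1 2 = r at *
  generalize radial γ t = d at *
  generalize unitTangent γ t 1 = u at *
  generalize unitTangent γ t 2 = v at *
  linear_combination hP + k * ((q ^ 2 + r ^ 2) * h1 - d ^ 2 * hP + (p * d + q * u + r * v) * h2)

theorem hasDerivAt_radial (hγ : IsBoundaryParam K T γ) (hK : IsConvexBody K) (t : ℝ) :
    HasDerivAt (radial γ) (deriv (radial γ) t) t := by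
  apply DifferentiableAt.hasDerivAt
  have h (i) := (hγ.hasDerivAt t i).differentiableAt
  have h' (i) := (hasDerivAt_unitTangent hγ hK t i).differentiableAt
  exact (((h 1).mul (h' 1)).add ((h 2).mul (h' 2))).div (h 0) (hγ.coord_zero_pos hK t).ne'

theorem deriv_unitTangent_zero (hγ : IsBoundaryParam K T γ) (hK : IsConvexBody K) (t : ℝ) :
    deriv (unitTangent γ) t 0 = -k * deriv (radial γ) t := by
  have h := hasDerivAt_unitTangent hγ hK t 0
  simp only [unitTangent_zero hγ hK] at h
  exact h.unique ((hasDerivAt_radial hγ hK t).const_mul (-k))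

/-- The geodesic curvature, with the `0`-th components written so that `k = 0` is no exception. -/
theorem geodCurv_mul_speed (hγ : IsBoundaryParam K T γ) (hK : IsConvexBody K) (t : ℝ) :
    geodCurv γ t * speed γ t =
      deriv (unitTangent γ) t 1 * rot k (γ t).1 (unitTangent γ t) 1 +
      deriv (unitTangent γ) t 2 * rot k (γ t).1 (unitTangent γ t) 2 -
      k * deriv (radial γ) t * supp γ t := by
  have hs := (speed_pos hγ hK t).ne'
  have h0 : rot k (γ t).1 (unitTangent γ t) 0 = k * supp γ t := by simp [rot, supp]
  simp only [geodCurv, inner, h0, Pi.smul_apply, smul_eq_mul, deriv_unitTangent_zero hγ hK]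
  by_cases hk : k = 0
  · subst hk; simp; field_simp
  · field_simp
    ring

/-- Obtained by differentiating `radial_mul` and `unitTangent_norm`; needed to reduce the derivative
of the normal to a multiple of the tangent. -/
theorem deriv_relations (hγ : IsBoundaryParam K T γ) (hK : IsConvexBody K) (t : ℝ) :
    (γ t).1 0 * deriv (radial γ) t = speed γ t + ((γ t).1 1 * deriv (unitTangent γ) t 1 +
      (γ t).1 2 * deriv (unitTangent γ) t 2) ∧
    unitTangent γ t 1 * deriv (unitTangent γ) t 1 + unitTangent γ t 2 * deriv (unitTangent γ) t 2 +
      k * radial γ t * deriv (radial γ) t = 0 := by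
  have h (i) := hγ.hasDerivAt t i
  have h' (i) := hasDerivAt_unitTangent hγ hK t i
  have hr := hasDerivAt_radial hγ hK t
  constructor
  · have e1 := (h 0).mul hr
    have e2 := ((h 1).mul (h' 1)).add ((h 2).mul (h' 2))
    have e3 := e1.congr_of_eventuallyEq (Eventually.of_forall fun s => (radial_mul hγ hK s).symm)
    have e := e3.unique e2
    simp only [vel_eq hγ hK, unitTangent_zero hγ hK] at e
    linear_combination e + speed γ t * unitTangent_norm hγ hK t
  · have e1 := (((h' 1).pow 2).add ((h' 2).pow 2)).add ((hr.pow 2).const_mul k)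
    have e2 := e1.congr_of_eventuallyEq
      (Eventually.of_forall fun s => (unitTangent_norm hγ hK s).symm)
    have e := e2.unique (hasDerivAt_const t 1)
    norm_num at e
    linarith

/-- The Frenet equation `n' = -κ u`: the derivative of the unit normal has no component along the
normal, nor along the position vector, which is orthogonal to both the normal and the velocity. -/
theorem hasDerivAt_normal (hγ : IsBoundaryParam K T γ) (hK : IsConvexBody K) (t : ℝ) :
    HasDerivAt (fun s => rot k (γ s).1 (unitTangent γ s) 1)
      (-(geodCurv γ t * speed γ t) * unitTangent γ t 1) t ∧
    HasDerivAt (fun s => rot k (γ s).1 (unitTangent γ s) 2)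
      (-(geodCurv γ t * speed γ t) * unitTangent γ t 2) t := by
  have h (i) := hγ.hasDerivAt t i
  have h' (i) := hasDerivAt_unitTangent hγ hK t i
  have hr := hasDerivAt_radial hγ hK t
  have hn := unitTangent_norm hγ hK t
  have hm := radial_mul hγ hK t
  obtain ⟨d1, d2⟩ := deriv_relations hγ hK t
  constructor
  · refine (((h 2).mul (h' 0)).sub ((h 0).mul (h' 2))).congr_deriv ?_
    rw [geodCurv_mul_speed hγ hK]
    simp only [vel_eq hγ hK, unitTangent_zero hγ hK, deriv_unitTangent_zero hγ hK, rot, supp,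
      Matrix.cons_val_zero, Matrix.cons_val_one, Matrix.cons_val]
    generalize (γ t).1 0 = p at *
    generalize (γ t).1 1 = q at *
    generalize (γ t).1 2 = r at *
    generalize deriv (radial γ) t = c at *
    generalize radial γ t = d at *
    generalize deriv (unitTangent γ) t 1 = a at *
    generalize deriv (unitTangent γ) t 2 = b at *
    generalize unitTangent γ t 1 = u at *
    generalize unitTangent γ t 2 = v at *
    linear_combination (-k * d * r - p * v) * d2 + b * (p * hn - k * d * hm) +
      k * c * (r * hn + v * hm)
  · refine (((h 0).mul (h' 1)).sub ((h 1).mul (h' 0))).congr_deriv ?_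
    rw [geodCurv_mul_speed hγ hK]
    simp only [vel_eq hγ hK, unitTangent_zero hγ hK, deriv_unitTangent_zero hγ hK, rot, supp,
      Matrix.cons_val_zero, Matrix.cons_val_one, Matrix.cons_val]
    generalize (γ t).1 0 = p at *
    generalize (γ t).1 1 = q at *
    generalize (γ t).1 2 = r at *
    generalize deriv (radial γ) t = c at *
    generalize radial γ t = d at *
    generalize deriv (unitTangent γ) t 1 = a at *
    generalize deriv (unitTangent γ) t 2 = b at *
    generalize unitTangent γ t 1 = u at *
    generalize unitTangent γ t 2 = v at *
    linear_combination (p * u + k * d * q) * d2 - a * (p * hn - k * d * hm) -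
      k * c * (q * hn + u * hm)

/-! ### Support lines are tangent lines -/

theorem side_eq (P w X : Fin 3 → ℝ) :
    side P w X = X 0 * (P 1 * w 2 - P 2 * w 1) + X 1 * (P 2 * w 0 - P 0 * w 2) +
      X 2 * (P 0 * w 1 - P 1 * w 0) := by
  refine (Matrix.det_fin_three _).trans ?_
  simp only [Matrix.cons_val_zero, Matrix.cons_val_one, Matrix.cons_val]
  ring

theorem side_polar (k r ω : ℝ) (X : Fin 3 → ℝ) :
    side (polar k r ω).1 ![0, -Real.sin ω, Real.cos ω] X =
      ell k r * X 0 - (1 - k * area k r) * (Real.cos ω * X 1 + Real.sin ω * X 2) := by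
  simp only [side_eq, polar, Matrix.cons_val_zero,
    Matrix.cons_val_one, Matrix.cons_val]
  linear_combination ell k r * X 0 * Real.sin_sq_add_cos_sq ω

theorem side_vel (hγ : IsBoundaryParam K T γ) (hK : IsConvexBody K) (t : ℝ) (X : Fin 3 → ℝ) :
    side (γ t).1 (vel γ t) X = speed γ t * (supp γ t * X 0 +
      rot k (γ t).1 (unitTangent γ t) 1 * X 1 + rot k (γ t).1 (unitTangent γ t) 2 * X 2) := by
  simp only [side_eq, supp, rot, Matrix.cons_val_one, Matrix.cons_val, vel_eq hγ hK]
  ring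

theorem normal_sq (hγ : IsBoundaryParam K T γ) (hK : IsConvexBody K) (t : ℝ) :
    rot k (γ t).1 (unitTangent γ t) 1 ^ 2 + rot k (γ t).1 (unitTangent γ t) 2 ^ 2 =
      1 - k * supp γ t ^ 2 := by
  rw [← supp_sq hγ hK]
  have h1 := unitTangent_norm hγ hK t
  have h2 := radial_mul hγ hK t
  have hP := (γ t).2.1
  simp only [rot, unitTangent_zero hγ hK, Matrix.cons_val_one, Matrix.cons_val]
  generalize (γ t).1 0 = p at *
  generalize (γ t).1 1 = q at *
  generalize (γ t).1 2 = r at *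
  generalize radial γ t = d at *
  generalize unitTangent γ t 1 = u at *
  generalize unitTangent γ t 2 = v at *
  linear_combination p ^ 2 * h1 - 2 * p * k * d * h2 + k * d ^ 2 * hP

/-- The support line is the tangent line. -/
theorem IsSupportLine.eq_tangent (hγ : IsBoundaryParam K T γ) (hK : IsConvexBody K) {t r ω : ℝ}
    (h : IsSupportLine K (γ t) r ω) :
    ell k r = supp γ t ∧
    rot k (γ t).1 (unitTangent γ t) 1 = -((1 - k * area k r) * Real.cos ω) ∧
    rot k (γ t).1 (unitTangent γ t) 2 = -((1 - k * area k r) * Real.sin ω) := by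
  have hs := speed_pos hγ hK t
  have hmem := h.mem
  rw [side_polar] at hmem
  -- The linear form of the support line is nonnegative along the curve and zero at `t`, so it also
  -- annihilates the velocity.
  have hd : ell k r * vel γ t 0 -
      (1 - k * area k r) * (Real.cos ω * vel γ t 1 + Real.sin ω * vel γ t 2) = 0 := by
    have hmin : IsLocalMin (fun s => ell k r * (γ s).1 0 -
        (1 - k * area k r) * (Real.cos ω * (γ s).1 1 + Real.sin ω * (γ s).1 2)) t := by
      refine Eventually.of_forall fun s => ?_
      have hsK : γ s ∈ K :=
        hK.isCompact.isClosed.frontier_subset (hγ.range_eq ▸ Set.mem_range_self s)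
      simpa only [hmem, side_polar] using h.supports _ hsK
    exact hmin.hasDerivAt_eq_zero (((hγ.hasDerivAt t 0).const_mul _).sub
      ((((hγ.hasDerivAt t 1).const_mul _).add ((hγ.hasDerivAt t 2).const_mul _)).const_mul _))
  simp only [vel_eq hγ hK] at hd
  replace hd : ell k r * unitTangent γ t 0 - (1 - k * area k r) *
      (Real.cos ω * unitTangent γ t 1 + Real.sin ω * unitTangent γ t 2) = 0 := by
    apply mul_left_cancel₀ hs.ne'
    linear_combination hd
  obtain ⟨Q, hQ⟩ := hK.nonempty_interior
  have hfQ := h.supports Q (interior_subset hQ)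
  have hNQ := hγ.oriented t Q hQ
  rw [side_polar] at hfQ
  rw [side_vel hγ hK, mul_pos_iff_of_pos_left hs] at hNQ
  have hn := normal_sq hγ hK t
  have hC := ell_area k r
  have hcs := Real.sin_sq_add_cos_sq ω
  obtain ⟨f1, hf1⟩ : ∃ f, f = -((1 - k * area k r) * Real.cos ω) := ⟨_, rfl⟩
  obtain ⟨f2, hf2⟩ : ∃ f, f = -((1 - k * area k r) * Real.sin ω) := ⟨_, rfl⟩
  have hf : f1 ^ 2 + f2 ^ 2 + k * ell k r ^ 2 = 1 := by
    rw [hf1, hf2]; linear_combination hC + (1 - k * area k r) ^ 2 * hcs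
  replace hmem : ell k r * (γ t).1 0 + f1 * (γ t).1 1 + f2 * (γ t).1 2 = 0 := by
    rw [hf1, hf2]; linear_combination hmem
  replace hd : ell k r * unitTangent γ t 0 + f1 * unitTangent γ t 1 +
      f2 * unitTangent γ t 2 = 0 := by
    rw [hf1, hf2]; linear_combination hd
  replace hfQ : 0 ≤ ell k r * Q.1 0 + f1 * Q.1 1 + f2 * Q.1 2 := by
    rw [hf1, hf2]; linarith
  rw [← hf1, ← hf2]
  obtain ⟨n1, hn1⟩ : ∃ n, n = rot k (γ t).1 (unitTangent γ t) 1 := ⟨_, rfl⟩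
  obtain ⟨n2, hn2⟩ : ∃ n, n = rot k (γ t).1 (unitTangent γ t) 2 := ⟨_, rfl⟩
  rw [← hn1, ← hn2] at hn hNQ ⊢
  have hn1' : n1 = (γ t).1 2 * unitTangent γ t 0 - (γ t).1 0 * unitTangent γ t 2 := hn1
  have hn2' : n2 = (γ t).1 0 * unitTangent γ t 1 - (γ t).1 1 * unitTangent γ t 0 := hn2
  have hm' : supp γ t = (γ t).1 1 * unitTangent γ t 2 - (γ t).1 2 * unitTangent γ t 1 := rfl
  -- The covector of the tangent line is `N = P × u`. Since `f = (ℓ(r), f1, f2)` annihilates `P` and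
  -- `u`, the product `f × N = P (f·u) - u (f·P)` vanishes; these are its three components.
  have c0 : f1 * n2 - f2 * n1 = 0 := by
    rw [hn1', hn2']
    linear_combination (γ t).1 0 * hd - unitTangent γ t 0 * hmem
  have c1 : f2 * supp γ t - ell k r * n2 = 0 := by
    rw [hm', hn2']
    linear_combination (γ t).1 1 * hd - unitTangent γ t 1 * hmem
  have c2 : ell k r * n1 - f1 * supp γ t = 0 := by
    rw [hm', hn1']
    linear_combination (γ t).1 2 * hd - unitTangent γ t 2 * hmem
  generalize supp γ t = m at *
  generalize ell k r = L at *
  -- Parallel covectors of norm `1` for the form with weights `(k, 1, 1)` differ by the factor `l`,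
  -- their pairing, and `l² = 1`. The interior point `Q`, strictly on the left of the tangent,
  -- excludes `l = -1`.
  obtain ⟨l, hl⟩ : ∃ l, l = k * L * m + f1 * n1 + f2 * n2 := ⟨_, rfl⟩
  have e0 : L = l * m := by rw [hl]; linear_combination (-L) * hn + n1 * c2 - n2 * c1
  have e1 : f1 = l * n1 := by rw [hl]; linear_combination (-f1) * hn + n2 * c0 - k * m * c2
  have e2 : f2 = l * n2 := by rw [hl]; linear_combination (-f2) * hn - n1 * c0 + k * m * c1
  have hl2 : l ^ 2 = 1 := by
    rw [e0, e1, e2] at hf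
    linear_combination hf - l ^ 2 * hn
  have hl1 : l = 1 := by
    rcases mul_self_eq_one_iff.1 (pow_two l ▸ hl2) with h | h
    · exact h
    · rw [e0, e1, e2, h] at hfQ
      linarith
  rw [hl1, one_mul] at e0 e1 e2
  exact ⟨e0, e1.symm, e2.symm⟩

/-! ### Derivatives along the curve and the Cauchy formula -/

theorem one_sub_supp_sq_pos (hγ : IsBoundaryParam K T γ) (hK : IsConvexBody K) (t : ℝ) :
    0 < 1 - k * supp γ t ^ 2 := by
  have h0 := hγ.coord_zero_pos hK t
  have h := supp_sq hγ hK t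
  rcases le_or_gt k 0 with hk | hk
  · nlinarith [mul_nonneg (neg_nonneg.2 hk) (sq_nonneg (supp γ t))]
  · rw [← h]; positivity

theorem cross_unitTangent_normal (hγ : IsBoundaryParam K T γ) (hK : IsConvexBody K) (t : ℝ) :
    unitTangent γ t 1 * rot k (γ t).1 (unitTangent γ t) 2 -
      unitTangent γ t 2 * rot k (γ t).1 (unitTangent γ t) 1 = (γ t).1 0 := by
  simp only [rot, unitTangent_zero hγ hK, Matrix.cons_val_one, Matrix.cons_val]
  linear_combination (γ t).1 0 * unitTangent_norm hγ hK t - k * radial γ t * radial_mul hγ hK t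

/-- In this form `radial` can be differentiated by the Frenet equation, and its vanishing can be
read off from `sin (ω - θ) = 0`. -/
theorem radial_eq_cross (hγ : IsBoundaryParam K T γ) (hK : IsConvexBody K) (t : ℝ) :
    (γ t).1 1 * rot k (γ t).1 (unitTangent γ t) 2 -
      (γ t).1 2 * rot k (γ t).1 (unitTangent γ t) 1 = radial γ t := by
  simp only [rot, unitTangent_zero hγ hK, Matrix.cons_val_one, Matrix.cons_val]
  linear_combination radial γ t * (γ t).2.1 - (γ t).1 0 * radial_mul hγ hK t

theorem hasDerivAt_radial' (hγ : IsBoundaryParam K T γ) (hK : IsConvexBody K) (t : ℝ) :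
    HasDerivAt (radial γ)
      (speed γ t * (γ t).1 0 - geodCurv γ t * speed γ t * supp γ t) t := by
  obtain ⟨d1, d2⟩ := hasDerivAt_normal hγ hK t
  have h := ((hγ.hasDerivAt t 1).mul d2).sub ((hγ.hasDerivAt t 2).mul d1)
  refine (h.congr_of_eventuallyEq
    (Eventually.of_forall fun s => (radial_eq_cross hγ hK s).symm)).congr_deriv ?_
  simp only [vel_eq hγ hK, supp]
  linear_combination speed γ t * cross_unitTangent_normal hγ hK t

theorem hasDerivAt_coord_zero (hγ : IsBoundaryParam K T γ) (hK : IsConvexBody K) (t : ℝ) :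
    HasDerivAt (fun s => (γ s).1 0) (-(k * speed γ t * radial γ t)) t := by
  refine (hγ.hasDerivAt t 0).congr_deriv ?_
  rw [vel_eq hγ hK, unitTangent_zero hγ hK]
  ring

theorem continuous_coord (hγ : IsBoundaryParam K T γ) (i : Fin 3) :
    Continuous fun t => (γ t).1 i :=
  continuous_iff_continuousAt.2 fun t => (hγ.hasDerivAt t i).continuousAt

theorem continuous_unitTangent (hγ : IsBoundaryParam K T γ) (hK : IsConvexBody K) (i : Fin 3) :
    Continuous fun t => unitTangent γ t i :=
  continuous_iff_continuousAt.2 fun t => (hasDerivAt_unitTangent hγ hK t i).continuousAt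

theorem continuous_supp (hγ : IsBoundaryParam K T γ) (hK : IsConvexBody K) :
    Continuous (supp γ) :=
  ((continuous_coord hγ 1).mul (continuous_unitTangent hγ hK 2)).sub
    ((continuous_coord hγ 2).mul (continuous_unitTangent hγ hK 1))

theorem continuous_geodCurv_mul_speed (hγ : IsBoundaryParam K T γ) (hK : IsConvexBody K) :
    Continuous fun t => geodCurv γ t * speed γ t := by
  have hu := continuous_pi_iff.1 ((contDiff_unitTangent hγ hK).continuous_deriv le_rfl)
  have hn1 := continuous_iff_continuousAt.2 fun t => (hasDerivAt_normal hγ hK t).1.continuousAt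
  have hn2 := continuous_iff_continuousAt.2 fun t => (hasDerivAt_normal hγ hK t).2.continuousAt
  refine ((((hu 1).mul hn1).add ((hu 2).mul hn2)).add
    ((hu 0).mul (continuous_supp hγ hK))).congr fun t => ?_
  rw [geodCurv_mul_speed hγ hK]
  simp only [Pi.add_apply, Pi.mul_apply, deriv_unitTangent_zero hγ hK]
  ring

/-- The perimeter as the integral of the support function against the rotation of the normal. -/
theorem perimeter_eq (hγ : IsBoundaryParam K T γ) (hK : IsConvexBody K) :
    perimeter T γ = ∫ t in (0 : ℝ)..T,
      supp γ t * (geodCurv γ t * speed γ t * (γ t).1 0 / (1 - k * supp γ t ^ 2)) := by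
  obtain ⟨G, hG⟩ := exists_antideriv k
  have hs : Continuous (speed γ) := (contDiff_speed hγ hK).continuous
  have hI : Continuous fun t =>
      supp γ t * (geodCurv γ t * speed γ t * (γ t).1 0 / (1 - k * supp γ t ^ 2)) :=
    (continuous_supp hγ hK).mul
      (((continuous_geodCurv_mul_speed hγ hK).mul (continuous_coord hγ 0)).div
        (continuous_const.sub (continuous_const.mul ((continuous_supp hγ hK).pow 2)))
        fun t => (one_sub_supp_sq_pos hγ hK t).ne')
  -- Here `radial / p₀` is minus the generalized tangent of `x`, so `G` of it is `-x` up to a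
  -- constant. The derivative expresses `-dx = ds - ℓ(r) dω`.
  have hd : ∀ t, HasDerivAt (fun s => G (radial γ s / (γ s).1 0))
      (speed γ t -
        supp γ t * (geodCurv γ t * speed γ t * (γ t).1 0 / (1 - k * supp γ t ^ 2))) t := by
    intro t
    have h0 := hγ.coord_zero_pos hK t
    have hY := one_sub_supp_sq_pos hγ hK t
    have hsq := supp_sq hγ hK t
    have e : 1 + k * (radial γ t / (γ t).1 0) ^ 2 = (1 - k * supp γ t ^ 2) / (γ t).1 0 ^ 2 := by
      rw [← hsq]; field_simp
    have hpos : 0 < 1 + k * (radial γ t / (γ t).1 0) ^ 2 := by rw [e]; positivity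
    refine ((hG _ hpos).comp t
      ((hasDerivAt_radial' hγ hK t).div (hasDerivAt_coord_zero hγ hK t) h0.ne')).congr_deriv ?_
    rw [e]
    field_simp
    linear_combination speed γ t * hsq
  have hper : radial γ T / (γ T).1 0 = radial γ 0 / (γ 0).1 0 := by
    have hp : γ T = γ 0 := by simpa using hγ.periodic 0
    have hv : vel γ T = vel γ 0 := by
      have h : (fun u => (γ (u + T)).1) = fun u => (γ u).1 := by
        funext u; rw [hγ.periodic u]
      have := deriv_comp_add_const (f := fun u => (γ u).1) (a := T) (x := 0)
      rw [h, zero_add] at this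
      exact this.symm
    simp only [radial, unitTangent, speed, hp, hv]
  have hint := intervalIntegral.integral_eq_sub_of_hasDerivAt (a := 0) (b := T)
    (fun t _ => hd t) ((hs.sub hI).intervalIntegrable 0 T)
  rw [hper, sub_self, intervalIntegral.integral_sub (hs.intervalIntegrable 0 T)
    (hI.intervalIntegrable 0 T)] at hint
  exact sub_eq_zero.1 hint

/-! ### Rigidity: comparison with the Minkowski integrand -/

/-- If a continuous curve solves a linear equation with coefficient continuous at `t`, and vanishes
at `t`, then it vanishes near `t`. -/
theorem eventually_eq_zero_of_linear {f g : ℝ → ℝ} {t : ℝ} (hg : ContinuousAt g t)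
    (hf : ∀ᶠ s in 𝓝 t, HasDerivAt f (g s * f s) s) (h0 : f t = 0) : ∀ᶠ s in 𝓝 t, f s = 0 := by
  have hb : ∀ᶠ s in 𝓝 t, ‖g s‖₊ ≤ ‖g t‖₊ + 1 :=
    (hg.nnnorm.eventually_lt continuousAt_const (lt_add_one ‖g t‖₊)).mono fun _ h => h.le
  refine ODE_solution_unique_of_eventually (v := fun s x => g s * x) (s := fun _ => Set.univ)
    (K := ‖g t‖₊ + 1) (g := fun _ => 0) (hb.mono fun s hs => ?_)
    (hf.mono fun s hs => ⟨hs, trivial⟩)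
    (Eventually.of_forall fun s => ⟨by simpa using hasDerivAt_const s (0 : ℝ), trivial⟩) h0
  refine (LipschitzWith.of_dist_le_mul fun x y => ?_).lipschitzOnWith
  rw [Real.dist_eq, Real.dist_eq, ← mul_sub, abs_mul]
  exact mul_le_mul_of_nonneg_right (by exact_mod_cast hs) (abs_nonneg _)

/-- Rigidity: if the Cauchy and the Minkowski integrands agree, then the boundary is a circle about
the origin. -/
theorem coord_zero_const (hγ : IsBoundaryParam K T γ) (hK : IsConvexBody K) (hk : k ≠ 0)
    (h : ∀ t, (γ t).1 0 ≠ 1 → geodCurv γ t * supp γ t * ((γ t).1 0 - (1 - k * supp γ t ^ 2)) =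
      (1 - (γ t).1 0) * (1 - k * supp γ t ^ 2)) :
    ∃ c, ∀ t, (γ t).1 0 = c := by
  have hp0 := continuous_coord hγ 0
  have hrad : Continuous (radial γ) :=
    continuous_iff_continuousAt.2 fun t => (hasDerivAt_radial hγ hK t).continuousAt
  have hs : Continuous (speed γ) := (contDiff_speed hγ hK).continuous
  have hcrit : ∀ t, -(k * speed γ t * radial γ t) = 0 → radial γ t = 0 := by
    intro t ht
    simpa [hk, (speed_pos hγ hK t).ne'] using ht
  -- a critical point off the origin propagates along the whole curve
  have hprop : ∀ t₀, radial γ t₀ = 0 → (γ t₀).1 0 ≠ 1 → ∀ t, (γ t).1 0 = (γ t₀).1 0 := by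
    intro t₀ hr0 hne
    set c := (γ t₀).1 0
    set S := {t | radial γ t = 0 ∧ (γ t).1 0 = c}
    have hclosed : IsClosed S :=
      (isClosed_eq hrad continuous_const).inter (isClosed_eq hp0 continuous_const)
    have hopen : IsOpen S := by
      rw [isOpen_iff_mem_nhds]
      rintro t ⟨ht, htc⟩
      -- If this difference vanished, the hypothesis would force `(1 - p₀)(1 - k m²) = 0`, where
      -- both factors are nonzero.
      have hY : ∀ s, (γ s).1 0 ≠ 1 → (γ s).1 0 - (1 - k * supp γ s ^ 2) ≠ 0 := by
        intro s hs1 hs2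
        have := h s hs1
        rw [hs2, mul_zero, eq_comm, mul_eq_zero] at this
        rcases this with h | h
        · exact hs1 (by linarith)
        · exact (one_sub_supp_sq_pos hγ hK s).ne' h
      -- Multiplying `radial' = speed (p₀ - κ m)` by `p₀ - (1 - k m²)` and inserting the hypothesis
      -- leaves `speed (p₀² - (1 - k m²))`, which is `-speed k radial²` by `supp_sq`. One factor
      -- `radial` is absorbed into the coefficient `g`, so the equation becomes linear.
      have hz : ∀ᶠ s in 𝓝 t, radial γ s = 0 := by
        refine eventually_eq_zero_of_linear (g := fun s => -(speed γ s * k * radial γ s) /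
          ((γ s).1 0 - (1 - k * supp γ s ^ 2))) ?_ ?_ ht
        · refine ContinuousAt.div ?_ ?_ (hY t (htc ▸ hne))
          · exact ((hs.mul continuous_const).mul hrad).neg.continuousAt
          · exact (hp0.sub (continuous_const.sub
              (continuous_const.mul ((continuous_supp hγ hK).pow 2)))).continuousAt
        · filter_upwards [hp0.continuousAt.eventually_ne (htc ▸ hne)] with s hs1
          refine (hasDerivAt_radial' hγ hK s).congr_deriv ?_
          have h1 := hY s hs1
          rw [div_mul_eq_mul_div, eq_div_iff h1]
          linear_combination speed γ s * supp_sq hγ hK s - speed γ s * h s hs1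
      obtain ⟨ε, hε, hball⟩ := Metric.eventually_nhds_iff_ball.1 hz
      refine mem_of_superset (Metric.ball_mem_nhds t hε) fun s hsb => ⟨hball s hsb, ?_⟩
      rw [← htc]
      refine Metric.isOpen_ball.is_const_of_deriv_eq_zero (f := fun s => (γ s).1 0)
        (convex_ball t ε).isPreconnected
        (fun u _ => (hγ.hasDerivAt u 0).differentiableAt.differentiableWithinAt) (fun u hu => ?_)
        hsb (Metric.mem_ball_self hε)
      rw [(hasDerivAt_coord_zero hγ hK u).deriv, hball u hu]
      simp
    have huniv : S = Set.univ := IsClopen.eq_univ ⟨hclosed, hopen⟩ ⟨t₀, hr0, rfl⟩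
    intro t
    exact (huniv ▸ Set.mem_univ t : t ∈ S).2
  have hcomp : IsCompact (Set.range fun t => (γ t).1 0) :=
    Function.Periodic.compact_of_continuous (c := T)
      (fun t => by simp only [hγ.periodic t]) hγ.pos.ne' hp0
  obtain ⟨_, ⟨a, rfl⟩, ha⟩ := hcomp.exists_isLeast (Set.range_nonempty _)
  obtain ⟨_, ⟨b, rfl⟩, hb⟩ := hcomp.exists_isGreatest (Set.range_nonempty _)
  have ha' : radial γ a = 0 := hcrit a <| IsLocalMin.hasDerivAt_eq_zero
    (Eventually.of_forall fun s => ha ⟨s, rfl⟩) (hasDerivAt_coord_zero hγ hK a)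
  have hb' : radial γ b = 0 := hcrit b <| IsLocalMax.hasDerivAt_eq_zero
    (Eventually.of_forall fun s => hb ⟨s, rfl⟩) (hasDerivAt_coord_zero hγ hK b)
  -- The propagation needs an extremum off the origin. If the minimum and the maximum of `p₀` are
  -- both `1`, then `p₀` is constant anyway.
  by_cases h1 : (γ a).1 0 = 1
  · by_cases h2 : (γ b).1 0 = 1
    · refine ⟨1, fun t => le_antisymm ?_ ?_⟩
      · exact (hb ⟨t, rfl⟩).trans h2.le
      · exact h1.ge.trans (ha ⟨t, rfl⟩)
    · exact ⟨_, hprop b hb' h2⟩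
  · exact ⟨_, hprop a ha' h1⟩

/-! ### Derivatives of the angles and the right triangle -/

/-- By `IsSupportLine.eq_tangent`, `ω` is a polar angle of `(-n₁, -n₂)`, a plane vector of length
`C(r) > 0`, whose derivative is given by the Frenet equation. -/
theorem hasDerivAt_supportAngle (hγ : IsBoundaryParam K T γ) (hK : IsConvexBody K) {r ω : ℝ → ℝ}
    (hsupp : ∀ t, IsSupportLine K (γ t) (r t) (ω t)) (hω : Continuous ω) (t : ℝ) :
    HasDerivAt ω (geodCurv γ t * speed γ t * (γ t).1 0 / (1 - k * supp γ t ^ 2)) t := by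
  obtain ⟨d1, d2⟩ := hasDerivAt_normal hγ hK t
  refine (hasDerivAt_polarAngle (R := fun s => 1 - k * area k (r s)) hω.continuousAt d1.neg d2.neg
    (Eventually.of_forall fun s => ?_)).congr_deriv ?_
  · obtain ⟨-, h1, h2⟩ := (hsupp s).eq_tangent hγ hK
    refine ⟨(cosFactor_pos (hsupp s).closest).ne', ?_, ?_⟩
    · simp only [Pi.neg_apply, h1, neg_neg]
    · simp only [Pi.neg_apply, h2, neg_neg]
  · simp only [Pi.neg_apply, neg_sq, normal_sq hγ hK]
    congr 1
    linear_combination geodCurv γ t * speed γ t * cross_unitTangent_normal hγ hK t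

theorem ell_sq_eq {P : Plane k} {ρ θ : ℝ} (h : P = polar k ρ θ) :
    ell k ρ ^ 2 = P.1 1 ^ 2 + P.1 2 ^ 2 := by
  subst h
  simp only [polar, Matrix.cons_val_one, Matrix.cons_val]
  linear_combination (-ell k ρ ^ 2) * Real.sin_sq_add_cos_sq θ

theorem eq_origin {P : Plane k} (h0 : 0 < P.1 0) (h1 : P.1 1 = 0) (h2 : P.1 2 = 0) :
    P = origin k := by
  have hP := P.2.1
  rw [h1, h2] at hP
  have h : P.1 0 = 1 := by nlinarith
  apply Subtype.ext
  ext i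
  fin_cases i
  · exact h
  · exact h1
  · exact h2

theorem ell_ne_zero (hγ : IsBoundaryParam K T γ) (hK : IsConvexBody K) {t ρ θ : ℝ}
    (h : γ t = polar k ρ θ) (hO : γ t ≠ origin k) : ell k ρ ≠ 0 := by
  intro he
  have := ell_sq_eq h
  rw [he] at this
  exact hO (eq_origin (hγ.coord_zero_pos hK t) (by nlinarith) (by nlinarith))

theorem hasDerivAt_polarAngle_boundary (hγ : IsBoundaryParam K T γ) (hK : IsConvexBody K)
    {ρ θ : ℝ → ℝ} (hpolar : ∀ t, γ t = polar k (ρ t) (θ t))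
    (hθ : ContinuousOn θ {t | γ t ≠ origin k}) {t : ℝ} (hO : γ t ≠ origin k) :
    HasDerivAt θ (speed γ t * supp γ t / ell k (ρ t) ^ 2) t := by
  have hcont : Continuous γ := hγ.contDiff.continuous.subtype_mk fun t => (γ t).2
  have hopen : IsOpen {t | γ t ≠ origin k} := isOpen_ne_fun hcont continuous_const
  refine (hasDerivAt_polarAngle (R := fun s => ell k (ρ s))
    (hθ.continuousAt (hopen.mem_nhds hO)) (hγ.hasDerivAt t 1) (hγ.hasDerivAt t 2) ?_).congr_deriv ?_
  · filter_upwards [hopen.mem_nhds hO] with s hs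
    refine ⟨ell_ne_zero hγ hK (hpolar s) hs, ?_, ?_⟩
    · rw [hpolar s]; rfl
    · rw [hpolar s]; rfl
  · rw [ell_sq_eq (hpolar t)]
    simp only [vel_eq hγ hK, supp]
    congr 1
    ring

theorem ell_sq_mul_deriv_polarAngle (hγ : IsBoundaryParam K T γ) (hK : IsConvexBody K)
    {ρ θ : ℝ → ℝ} (hpolar : ∀ t, γ t = polar k (ρ t) (θ t))
    (hθ : ContinuousOn θ {t | γ t ≠ origin k}) (t : ℝ) :
    ell k (ρ t) ^ 2 * deriv θ t = speed γ t * supp γ t := by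
  -- At the origin both sides vanish, whatever value `deriv θ t` takes there, so integrating over
  -- the full period does no harm.
  by_cases hO : γ t = origin k
  · rw [ell_sq_eq (hpolar t)]
    simp [supp, hO, origin]
  · rw [(hasDerivAt_polarAngle_boundary hγ hK hpolar hθ hO).deriv,
      mul_div_cancel₀ _ (pow_ne_zero 2 (ell_ne_zero hγ hK (hpolar t) hO))]

theorem cosFactor_rho {P : Plane k} {ρ θ : ℝ} (h : P = polar k ρ θ) :
    1 - k * area k ρ = P.1 0 := by
  subst h; rfl

/-- The hyperbolic, Euclidean or spherical theorem of Pythagoras in the triangle formed by the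
origin, a boundary point and the foot of the perpendicular to the support line. -/
theorem cosFactor_thirdSide (hγ : IsBoundaryParam K T γ) (hK : IsConvexBody K) {t ρ θ r ω : ℝ}
    (hpolar : γ t = polar k ρ θ) (hsupp : IsSupportLine K (γ t) r ω) :
    1 - k * area k (thirdSide (γ t) θ r ω) = (γ t).1 0 / (1 - k * area k r) ∧
      (0 < k → |√k * thirdSide (γ t) θ r ω| < Real.pi) := by
  have h0 := hγ.coord_zero_pos hK t
  have hC := cosFactor_pos hsupp.closest
  obtain ⟨hL, h1, h2⟩ := hsupp.eq_tangent hγ hK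
  have hmem := hsupp.mem
  rw [side_polar] at hmem
  have hCL := ell_area k r
  have hsq := supp_sq hγ hK t
  have hrad := radial_eq_cross hγ hK t
  rw [h1, h2] at hrad
  rw [← hL] at hsq
  have hsq' : (γ t).1 0 ^ 2 + k * radial γ t ^ 2 = (1 - k * area k r) ^ 2 := by
    linear_combination hsq - hCL
  have hF0 : (polar k r ω).1 0 = 1 - k * area k r := rfl
  have hF1 : (polar k r ω).1 1 = ell k r * Real.cos ω := rfl
  have hF2 : (polar k r ω).1 2 = ell k r * Real.sin ω := rfl
  have hP1 : (γ t).1 1 = ell k ρ * Real.cos θ := by rw [hpolar]; rfl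
  have hP2 : (γ t).1 2 = ell k ρ * Real.sin θ := by rw [hpolar]; rfl
  have hzero : radial γ t = 0 ∨ k = 0 → (γ t).1 0 / (1 - k * area k r) = 1 := by
    intro h
    rw [div_eq_one_iff_eq hC.ne']
    have : k * radial γ t ^ 2 = 0 := by rcases h with h | h <;> simp [h]
    rw [this, add_zero] at hsq'
    exact (sq_eq_sq₀ h0.le hC.le).1 hsq'
  refine cosFactor_sign_mul_dist (γ t) (polar k r ω) (Real.sin (ω - θ)) _ ?_ (by positivity)
    ?_ ?_ (fun h => hzero (Or.inr h)) (fun h => hzero (Or.inl ?_))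
  -- The pairing of `P` with the foot `F` is `p₀ C(r) + k ℓ(r) (p₁ cos ω + p₂ sin ω)`; the equation
  -- of the support line and `C² + k ℓ² = 1` reduce it to `p₀ / C(r)`.
  · rw [hF0, hF1, hF2, div_eq_iff hC.ne']
    linear_combination (-(γ t).1 0) * hCL + k * ell k r * hmem
  · intro hk
    rw [div_le_one hC]
    exact (sq_le_sq₀ h0.le hC.le).1 (by nlinarith [mul_nonneg hk.le (sq_nonneg (radial γ t))])
  · intro hk
    rw [le_div_iff₀ hC, one_mul]
    exact (sq_le_sq₀ hC.le h0.le).1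
      (by nlinarith [mul_nonneg (neg_pos.2 hk).le (sq_nonneg (radial γ t))])
  -- When the sign in `thirdSide` is `0`, the signed distance is `0` by definition, so the cosine
  -- must be shown to be `1`; this follows from `radial = -C(r) ℓ(ρ) sin (ω - θ)`.
  · rw [← hrad, hP1, hP2]
    rw [Real.sin_sub] at h
    linear_combination (-(1 - k * area k r) * ell k ρ) * h

theorem ellCurv_supportLine {P : Plane k} {r ω : ℝ} (h : IsSupportLine K P r ω) :
    ellCurv k r = 1 - k * area k r := by
  refine ellCurv_eq fun hk => ?_
  have ha : 0 < √k := Real.sqrt_pos.2 hk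
  have hr := h.closest hk
  rw [lt_div_iff₀ (by positivity)] at hr
  rw [abs_mul, abs_of_pos ha]
  linarith [Real.pi_pos]

end ConstCurv

/-! ### The perimeter formulas -/

theorem theorem5p2 (k : ℝ) (K : Set (ConstCurv.Plane k)) (hK : ConstCurv.IsConvexBody K)
    (T : ℝ) (γ : ℝ → ConstCurv.Plane k) (hγ : ConstCurv.IsBoundaryParam K T γ)
    -- `ρ` and `θ` are polar coordinates along the boundary; `θ` is a continuous choice of the polar
    -- angle where the boundary does not meet the origin
    (ρ θ : ℝ → ℝ) (hρ : ∀ t, ρ t = ConstCurv.rho (γ t))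
    (hpolar : ∀ t, γ t = ConstCurv.polar k (ρ t) (θ t))
    (hθ : ContinuousOn θ {t | γ t ≠ ConstCurv.origin k})
    -- the support line at each boundary point, with a continuous choice of its angle `ω`
    (r ω : ℝ → ℝ) (hsupp : ∀ t, ConstCurv.IsSupportLine K (γ t) (r t) (ω t))
    (hω : Continuous ω)
    (x : ℝ → ℝ) (hx : ∀ t, x t = ConstCurv.thirdSide (γ t) (θ t) (r t) (ω t)) :
    -- the derivatives of the angles exist
    (Differentiable ℝ ω ∧ ∀ t, γ t ≠ ConstCurv.origin k → DifferentiableAt ℝ θ t) ∧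
    -- the formulas for the perimeter
    ConstCurv.perimeter T γ =
      ∫ t in (0 : ℝ)..T,
        ConstCurv.ell k (ρ t) ^ 2 * (deriv ω t / ConstCurv.speed γ t) * deriv θ t ∧
    ConstCurv.perimeter T γ =
      ∫ t in (0 : ℝ)..T,
        ConstCurv.geodCurv γ t * ConstCurv.ell k (ρ t) ^ 2 *
          (ConstCurv.ellCurv k (x t) / ConstCurv.ellCurv k (r t)) * deriv θ t ∧
    ConstCurv.perimeter T γ =
      ∫ t in (0 : ℝ)..T,
        ConstCurv.geodCurv γ t * ConstCurv.ell k (ρ t) ^ 2 *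
          ((1 - k * ConstCurv.area k (x t)) / (1 - k * ConstCurv.area k (r t))) * deriv θ t ∧
    -- the first integrand is the Cauchy integrand `ℓ(r) dω`
    (∀ t, γ t ≠ ConstCurv.origin k →
      ConstCurv.ell k (r t) * deriv ω t =
        ConstCurv.ell k (ρ t) ^ 2 * (deriv ω t / ConstCurv.speed γ t) * deriv θ t) ∧
    -- for `k ≠ 0` it is not the Minkowski integrand `κ ℓ(ρ)² dθ + k a(ρ) ds`, unless the boundary is
    -- a circle centred at the origin
    (k ≠ 0 → (¬ ∃ R, ∀ t, ρ t = R) →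
      ∃ t, γ t ≠ ConstCurv.origin k ∧
        ConstCurv.ell k (ρ t) ^ 2 * (deriv ω t / ConstCurv.speed γ t) * deriv θ t ≠
          ConstCurv.geodCurv γ t * ConstCurv.ell k (ρ t) ^ 2 * deriv θ t +
            k * ConstCurv.area k (ρ t) * ConstCurv.speed γ t) := by
  have hsp := ConstCurv.speed_pos hγ hK
  have hdω := ConstCurv.hasDerivAt_supportAngle hγ hK hsupp hω
  have hdθ := ConstCurv.ell_sq_mul_deriv_polarAngle hγ hK hpolar hθ
  have hL : ∀ t, ConstCurv.ell k (r t) = ConstCurv.supp γ t := fun t =>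
    ((hsupp t).eq_tangent hγ hK).1
  have hCsq : ∀ t, (1 - k * ConstCurv.area k (r t)) ^ 2 = 1 - k * ConstCurv.supp γ t ^ 2 := by
    intro t
    rw [← hL]
    linear_combination ConstCurv.ell_area k (r t)
  have hthird : ∀ t, 1 - k * ConstCurv.area k (x t) =
      (γ t).1 0 / (1 - k * ConstCurv.area k (r t)) ∧ (0 < k → |√k * x t| < Real.pi) := by
    intro t
    rw [hx]
    exact ConstCurv.cosFactor_thirdSide hγ hK (hpolar t) (hsupp t)
  have hcauchy : ∀ t, ConstCurv.ell k (ρ t) ^ 2 * (deriv ω t / ConstCurv.speed γ t) * deriv θ t =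
      ConstCurv.supp γ t * (ConstCurv.geodCurv γ t * ConstCurv.speed γ t * (γ t).1 0 /
        (1 - k * ConstCurv.supp γ t ^ 2)) := by
    intro t
    have h := (hsp t).ne'
    rw [mul_right_comm, hdθ, (hdω t).deriv, mul_div_assoc', mul_assoc, mul_div_cancel_left₀ _ h]
  have harea : ∀ t, ConstCurv.geodCurv γ t * ConstCurv.ell k (ρ t) ^ 2 *
        ((1 - k * ConstCurv.area k (x t)) / (1 - k * ConstCurv.area k (r t))) * deriv θ t =
      ConstCurv.supp γ t * (ConstCurv.geodCurv γ t * ConstCurv.speed γ t * (γ t).1 0 /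
        (1 - k * ConstCurv.supp γ t ^ 2)) := by
    intro t
    rw [mul_right_comm, mul_assoc (ConstCurv.geodCurv γ t), hdθ, (hthird t).1, ← hCsq, div_div,
      ← pow_two]
    ring
  have hper := ConstCurv.perimeter_eq hγ hK
  refine ⟨⟨fun t => (hdω t).differentiableAt, fun t ht =>
    (ConstCurv.hasDerivAt_polarAngle_boundary hγ hK hpolar hθ ht).differentiableAt⟩, ?_, ?_, ?_,
    fun t _ => ?_, fun hk hcirc => ?_⟩
  · simp only [hcauchy, hper]
  · simp only [fun t => ConstCurv.ellCurv_eq (hthird t).2,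
      fun t => ConstCurv.ellCurv_supportLine (hsupp t), harea, hper]
  · simp only [harea, hper]
  · rw [hcauchy, hL, (hdω t).deriv]
  · by_contra! hall
    obtain ⟨c, hc⟩ := ConstCurv.coord_zero_const hγ hK hk fun t ht => by
      have hY := ConstCurv.one_sub_supp_sq_pos hγ hK t
      have h := hall t fun hO => ht (by rw [hO]; rfl)
      rw [hcauchy, mul_assoc _ _ (deriv θ t), hdθ, mul_div_assoc', div_eq_iff hY.ne'] at h
      apply mul_left_cancel₀ (hsp t).ne'
      linear_combination h - ConstCurv.speed γ t * (1 - k * ConstCurv.supp γ t ^ 2) *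
        ConstCurv.cosFactor_rho (hpolar t)
    -- The pairing of `O` with a point is its coordinate `p₀`, so constant `p₀ = c` makes the
    -- distance `ρ` constant.
    refine hcirc ⟨if 0 < k then Real.arccos c / √k else Real.arcosh c / √(-k), fun t => ?_⟩
    rw [hρ]
    simp [ConstCurv.rho, ConstCurv.dist, ConstCurv.origin, hc, hk]
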